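/- \textbf{Theorem (Paley--Wiener-type perturbation).} Let $\mathcal H$ be a separable complex Hilbert space. A countable family $\{f_n\}$ in $\mathcal H$ is \emph{Bessel} if there is $M>0$ with $\sum_n|\langle x,f_n\rangle|^2\le M\|x\|^2$ for all $x\in\mathcal H$; a Bessel family is a \emph{frame} if there is $m>0$ with $m\|x\|^2\le\sum_n|\langle x,f_n\rangle|^2$ for all $x\in\mathcal H$, a \emph{Riesz sequence} if there is $m>0$ with $m\sum_n|c_n|^2\le\|\sum_n c_nf_n\|^2$ for all $(c_n)\in\ell^2$, and a \emph{Riesz basis} if it is both a frame and a Riesz sequence. A Bessel sequence $\{f_n\}_{n=1}^\infty$ is a \emph{pseudo-Riesz sequence} if $\{f_n\}_{n\notin\sigma}$ is a Riesz sequence for some finite $\sigma\subseteq\mathbb N$; a \emph{pseudo-frame} if it becomes a frame after adding finitely many vectors of $\mathcal H$ to it; and a \emph{pseudo-Riesz basis} if it becomes a Riesz basis for $\mathcal H$ after removing finitely many of its members and adding finitely many vectors of $\mathcal H$. For a Bessel sequence $\{f_n\}_{n=1}^\infty$ let $S_f:\ell^2(\mathbb N)\to\mathcal H$, $S_fc=\sum_n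 c_nf_n$, be its synthesis operator, with null space $\mathcal N_{S_f}$, and let \[\gamma(S_f)=\inf_{u\notin\mathcal N_{S_f}}\frac{\|S_fu\|}{d(u,\mathcal N_{S_f})}\in[0,\infty],\] where $d(u,\mathcal N_{S_f})=\inf_{v\in\mathcal N_{S_f}}\|u-v\|$ and $\inf\emptyset=\infty$ (the case $S_f=0$). Let $\{f_n\}_{n=1}^\infty$ be a pseudo-Riesz sequence (resp.\ pseudo-frame, pseudo-Riesz basis) in $\mathcal H$, let $\{g_n\}_{n=1}^\infty$ be a sequence in $\mathcal H$, and let $\lambda,\mu\ge 0$ be constants such that \[\Big\|\sum_{i=1}^n c_i(g_i-f_i)\Big\|\le\lambda\Big\|\sum_{i=1}^n c_if_i\Big\|+\mu\Big(\sum_{i=1}^n|c_i|^2\Big)^{1/2}\] for all $n\ge1$ and all $c_1,\dots,c_n\in\mathbb C$, and $\mu<(1-\lambda)\gamma(S_f)$ (with $0\cdot\infty=0$). Then $\{g_n\}_{n=1}^\infty$ is also a pseudo-Riesz sequence (resp.\ pseudo-frame, pseudo-Riesz basis) in $\mathcal H$. -/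

import Mathlib

namespace HilbertSeq

/-- The Hilbert space of square-summable complex families indexed by `ι`. -/
noncomputable abbrev Ell2 (ι : Type*) := lp (fun _ : ι => ℂ) 2

section

variable {ι H : Type*} [NormedAddCommGroup H] [InnerProductSpace ℂ H]

/-- Bessel families: `∑ |⟨x, f i⟩|² ≤ M ‖x‖²`, where convergence of the series is part of the
condition. -/
def IsBessel (f : ι → H) : Prop :=
  ∃ M : ℝ, 0 < M ∧ ∀ x : H,
    Summable (fun i => ‖inner ℂ x (f i)‖ ^ 2) ∧
      ∑' i, ‖inner ℂ x (f i)‖ ^ 2 ≤ M * ‖x‖ ^ 2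

/-- The synthesis map `c ↦ ∑ c i • f i` on `ℓ²`. It is only used for Bessel families, for which
the series converges (unconditionally) for every `c` in `ℓ²`. -/
noncomputable def synthesis (f : ι → H) (c : Ell2 ι) : H := ∑' i, c i • f i

/-- Frames for `H`. -/
def IsFrame (f : ι → H) : Prop :=
  IsBessel f ∧ ∃ m : ℝ, 0 < m ∧ ∀ x : H, m * ‖x‖ ^ 2 ≤ ∑' i, ‖inner ℂ x (f i)‖ ^ 2

/-- Riesz sequences in `H`. -/
def IsRieszSequence (f : ι → H) : Prop :=
  IsBessel f ∧ ∃ m : ℝ, 0 < m ∧ ∀ c : Ell2 ι, m * ∑' i, ‖c i‖ ^ 2 ≤ ‖synthesis f c‖ ^ 2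

/-- Riesz bases for `H`. -/
def IsRieszBasis (f : ι → H) : Prop := IsFrame f ∧ IsRieszSequence f

/-- A Bessel sequence that becomes a frame after adding finitely many vectors. -/
def IsPseudoFrame (f : ℕ → H) : Prop :=
  IsBessel f ∧ ∃ (m : ℕ) (h : Fin m → H), IsFrame (Sum.elim h f)

/-- A Bessel sequence that becomes a Riesz sequence after removing finitely many of its
members. -/
def IsPseudoRieszSequence (f : ℕ → H) : Prop :=
  IsBessel f ∧ ∃ σ : Finset ℕ, IsRieszSequence (fun n : {n : ℕ // n ∉ σ} => f n)

/-- A Bessel sequence that becomes a Riesz basis for `H` after removing finitely many of its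
members and adding finitely many vectors. -/
def IsPseudoRieszBasis (f : ℕ → H) : Prop :=
  IsBessel f ∧ ∃ (σ : Finset ℕ) (m : ℕ) (h : Fin m → H),
    IsRieszBasis (Sum.elim h (fun n : {n : ℕ // n ∉ σ} => f n))

/-- The null space of the synthesis map. -/
def nullSpace (f : ι → H) : Set (Ell2 ι) := {c | synthesis f c = 0}

/-- The reduced minimum modulus `inf {‖S c‖ / d(c, N) : c ∉ N}` of the synthesis map `S` with null
space `N`, as an extended real: the infimum of the empty set (the case `S = 0`) is `⊤`. -/
noncomputable def reducedMinModulus (f : ι → H) : EReal :=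
  ⨅ (c : Ell2 ι) (_ : c ∉ nullSpace f),
    ((‖synthesis f c‖ / Metric.infDist c (nullSpace f) : ℝ) : EReal)

end

end HilbertSeq

/-! Let `T` and `A` be the synthesis operators of `f` and `g`. On `(ker T)ᗮ` one has `γ‖u‖ ≤ ‖T u‖`,
so the gap condition turns the perturbation bound into `‖A u - T u‖ ≤ κ‖T u‖` with `κ = λ + μ/γ < 1`
(`IsBessel.exists_relative_bound`).

For a pseudo-Riesz sequence `ker T` is finite-dimensional and `A` is bounded below on its orthogonal
complement. A finite-dimensional subspace is nearly orthogonal to all sequences vanishing on a large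
finite set, so `A` stays bounded below on those (`exists_finset_bounded_below`).

For a pseudo-frame, `A = U T` on `(ker T)ᗮ` with `‖U - 1‖ ≤ κ`, whence `‖T* U* x‖ ≤ ‖A* x‖`
(`exists_intertwining`). The frame inequality for `f` and the added vectors `h i`, taken at `U* x`,
becomes one for `g` and the `U (h i)`.

A pseudo-Riesz basis is exactly a sequence that is both, so the third case follows from the other
two. -/

namespace HilbertSeq

open ContinuousLinearMap

/-! ### Square-summable families and the analysis and synthesis operators -/

section

variable {ι κ H : Type*}

lemma summable_norm_sq (c : Ell2 ι) : Summable fun i => ‖c i‖ ^ 2 := by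
  simpa using (memℓp_gen_iff (p := 2) (by norm_num)).1 (lp.memℓp c)

lemma norm_sq_eq_tsum (c : Ell2 ι) : ‖c‖ ^ 2 = ∑' i, ‖c i‖ ^ 2 := by
  simpa using lp.norm_rpow_eq_tsum (p := 2) (by norm_num) c

lemma memℓp_two_of_summable {c : ι → ℂ} (h : Summable fun i => ‖c i‖ ^ 2) :
    Memℓp (E := fun _ : ι => ℂ) c 2 :=
  memℓp_gen (by simpa using h)

lemma norm_eq_of_injective {j : κ → ι} (hj : Function.Injective j) {c : Ell2 ι}
    {d : Ell2 κ} (hd : ∀ k, d k = c (j k)) (hc : ∀ i, i ∉ Set.range j → c i = 0) :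
    ‖d‖ = ‖c‖ := by
  have : ‖d‖ ^ 2 = ‖c‖ ^ 2 := by
    rw [norm_sq_eq_tsum, norm_sq_eq_tsum, ← hj.tsum_eq (f := fun i => ‖c i‖ ^ 2)]
    · simp_rw [hd]
    · intro i hi
      by_contra h
      exact hi (by simp [hc i h])
  exact (sq_eq_sq₀ (norm_nonneg _) (norm_nonneg _)).1 this

/-- Extension by zero along an injective map of index sets. -/
lemma exists_extend {j : κ → ι} (hj : Function.Injective j) (d : Ell2 κ) :
    ∃ c : Ell2 ι, (∀ k, d k = c (j k)) ∧ ∀ i, i ∉ Set.range j → c i = 0 := by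
  have hs : Summable fun i => ‖Function.extend j (fun k => d k) 0 i‖ ^ 2 := by
    rw [← hj.summable_iff]
    · simpa [Function.comp_def, hj.extend_apply] using summable_norm_sq d
    · intro i hi
      rw [Function.extend_apply' _ _ _ (by simpa using hi)]
      simp
  refine ⟨⟨_, memℓp_two_of_summable hs⟩, fun k => (hj.extend_apply _ _ k).symm, fun i hi => ?_⟩
  exact Function.extend_apply' _ _ _ (by simpa using hi)

/-- Restriction along an injective map of index sets. -/
lemma exists_restrict {j : κ → ι} (hj : Function.Injective j) (c : Ell2 ι) :
    ∃ d : Ell2 κ, ∀ k, d k = c (j k) :=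
  ⟨⟨fun k => c (j k), memℓp_two_of_summable ((summable_norm_sq c).comp_injective hj)⟩,
    fun _ => rfl⟩

variable [NormedAddCommGroup H] [InnerProductSpace ℂ H]

lemma synthesis_comp_injective {j : κ → ι} (hj : Function.Injective j) {c : Ell2 ι}
    {d : Ell2 κ} (hd : ∀ k, d k = c (j k)) (hc : ∀ i, i ∉ Set.range j → c i = 0) (f : ι → H) :
    synthesis (fun k => f (j k)) d = synthesis f c := by
  unfold synthesis
  rw [← hj.tsum_eq (f := fun i => c i • f i)]
  · simp_rw [hd]
  · intro i hi
    by_contra h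
    exact hi (by simp [hc i h])

lemma IsBessel.comp_injective {f : ι → H} (hf : IsBessel f) {j : κ → ι}
    (hj : Function.Injective j) : IsBessel fun k => f (j k) := by
  obtain ⟨M, hM, h⟩ := hf
  refine ⟨M, hM, fun x => ⟨(h x).1.comp_injective hj, le_trans ?_ (h x).2⟩⟩
  exact tsum_comp_le_tsum_of_inj (h x).1 (fun _ => by positivity) hj

lemma isBessel_of_finite [Finite ι] (f : ι → H) : IsBessel f := by
  have := Fintype.ofFinite ι
  refine ⟨∑ i, ‖f i‖ ^ 2 + 1, by positivity, fun x => ⟨Summable.of_finite, ?_⟩⟩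
  rw [tsum_fintype]
  calc ∑ i, ‖inner ℂ x (f i)‖ ^ 2 ≤ ∑ i, ‖f i‖ ^ 2 * ‖x‖ ^ 2 := by
        refine Finset.sum_le_sum fun i _ => ?_
        rw [← mul_pow, mul_comm]
        gcongr
        exact norm_inner_le_norm x (f i)
    _ = (∑ i, ‖f i‖ ^ 2) * ‖x‖ ^ 2 := by rw [Finset.sum_mul]
    _ ≤ _ := by gcongr; linarith

lemma IsBessel.tsum_elim {h : κ → H} {f : ι → H} (hh : IsBessel h) (hf : IsBessel f) (x : H) :
    ∑' i, ‖inner ℂ x (Sum.elim h f i)‖ ^ 2 =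
      ∑' k, ‖inner ℂ x (h k)‖ ^ 2 + ∑' i, ‖inner ℂ x (f i)‖ ^ 2 := by
  obtain ⟨_, _, h₁⟩ := hh
  obtain ⟨_, _, h₂⟩ := hf
  exact Summable.tsum_sum (f := fun i => ‖inner ℂ x (Sum.elim h f i)‖ ^ 2) (h₁ x).1 (h₂ x).1

lemma IsBessel.elim {h : κ → H} {f : ι → H} (hh : IsBessel h) (hf : IsBessel f) :
    IsBessel (Sum.elim h f) := by
  have key := hh.tsum_elim hf
  obtain ⟨M₁, hM₁, h₁⟩ := hh
  obtain ⟨M₂, hM₂, h₂⟩ := hf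
  refine ⟨M₁ + M₂, by positivity, fun x => ⟨?_, ?_⟩⟩
  · exact (HasSum.sum (f := fun i => ‖inner ℂ x (Sum.elim h f i)‖ ^ 2)
      (h₁ x).1.hasSum (h₂ x).1.hasSum).summable
  · rw [key x, add_mul]
    exact add_le_add (h₁ x).2 (h₂ x).2

/-- The analysis operator `x ↦ (⟨f i, x⟩)` of a Bessel family. -/
noncomputable def IsBessel.analysis {f : ι → H} (hf : IsBessel f) : H →L[ℂ] Ell2 ι :=
  LinearMap.mkContinuous
    { toFun := fun x => ⟨fun i => inner ℂ (f i) x, memℓp_two_of_summable (by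
        obtain ⟨_, _, h⟩ := hf
        simpa only [norm_inner_symm] using (h x).1)⟩
      map_add' := fun x y => by ext i; exact inner_add_right _ _ _
      map_smul' := fun a x => by ext i; exact inner_smul_right _ _ _ }
    (Real.sqrt hf.choose) fun x => by
      refine abs_le_of_sq_le_sq' ?_ (by positivity) |>.2
      rw [norm_sq_eq_tsum, mul_pow, Real.sq_sqrt hf.choose_spec.1.le]
      refine (tsum_congr fun i => ?_).trans_le (hf.choose_spec.2 x).2
      rw [norm_inner_symm]
      rfl

lemma IsBessel.analysis_apply {f : ι → H} (hf : IsBessel f) (x : H) (i : ι) :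
    hf.analysis x i = inner ℂ (f i) x := rfl

lemma IsBessel.norm_sq_analysis {f : ι → H} (hf : IsBessel f) (x : H) :
    ‖hf.analysis x‖ ^ 2 = ∑' i, ‖inner ℂ x (f i)‖ ^ 2 := by
  rw [norm_sq_eq_tsum]
  exact tsum_congr fun i => by rw [hf.analysis_apply, norm_inner_symm]

lemma IsBessel.isRieszSequence_iff {f : ι → H} (hf : IsBessel f) :
    IsRieszSequence f ↔ ∃ m : ℝ, 0 < m ∧ ∀ c : Ell2 ι, m * ‖c‖ ≤ ‖synthesis f c‖ := by
  constructor
  · rintro ⟨-, m, hm, h⟩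
    refine ⟨Real.sqrt m, Real.sqrt_pos.2 hm, fun c => ?_⟩
    refine (abs_le_of_sq_le_sq' ?_ (norm_nonneg _)).2
    rw [mul_pow, Real.sq_sqrt hm.le, norm_sq_eq_tsum]
    exact h c
  · rintro ⟨m, hm, h⟩
    refine ⟨hf, m ^ 2, by positivity, fun c => ?_⟩
    rw [← norm_sq_eq_tsum, ← mul_pow]
    exact pow_le_pow_left₀ (by positivity) (h c) 2

variable [CompleteSpace H]

/-- The synthesis map of a Bessel family as a bounded operator. -/
noncomputable def IsBessel.synthesisCLM {f : ι → H} (hf : IsBessel f) : Ell2 ι →L[ℂ] H :=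
  adjoint hf.analysis

lemma IsBessel.inner_synthesisCLM {f : ι → H} (hf : IsBessel f) (c : Ell2 ι) (x : H) :
    inner ℂ (hf.synthesisCLM c) x = inner ℂ c (hf.analysis x) :=
  adjoint_inner_left _ _ _

lemma IsBessel.adjoint_synthesisCLM {f : ι → H} (hf : IsBessel f) :
    adjoint hf.synthesisCLM = hf.analysis := adjoint_adjoint _

/-- The expansion of `c` in coordinate vectors converges in `ℓ²`, and a bounded operator preserves
its sum. -/
lemma IsBessel.hasSum_synthesisCLM {f : ι → H} (hf : IsBessel f) (c : Ell2 ι) :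
    HasSum (fun i => c i • f i) (hf.synthesisCLM c) := by
  classical
  have h := (lp.hasSum_single (p := 2) (by norm_num) c).mapL hf.synthesisCLM
  refine h.congr_fun fun i => ?_
  refine ext_inner_right ℂ fun x => ?_
  rw [hf.inner_synthesisCLM, lp.inner_single_left, hf.analysis_apply, inner_smul_left]
  simp [mul_comm]

lemma IsBessel.synthesis_eq {f : ι → H} (hf : IsBessel f) (c : Ell2 ι) :
    synthesis f c = hf.synthesisCLM c :=
  (hf.hasSum_synthesisCLM c).tsum_eq

/-- The Riesz property of a subfamily in terms of the synthesis map of the whole family. -/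
lemma IsBessel.isRieszSequence_comp_iff {f : ι → H} (hf : IsBessel f) {j : κ → ι}
    (hj : Function.Injective j) :
    IsRieszSequence (fun k => f (j k)) ↔ ∃ m : ℝ, 0 < m ∧
      ∀ c : Ell2 ι, (∀ i, i ∉ Set.range j → c i = 0) → m * ‖c‖ ≤ ‖hf.synthesisCLM c‖ := by
  rw [(hf.comp_injective hj).isRieszSequence_iff]
  refine exists_congr fun m => and_congr_right fun _ => ⟨fun h c hc => ?_, fun h d => ?_⟩
  · obtain ⟨d, hd⟩ := exists_restrict hj c
    have := h d
    rwa [norm_eq_of_injective hj hd hc, synthesis_comp_injective hj hd hc f,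
      hf.synthesis_eq] at this
  · obtain ⟨c, hd, hc⟩ := exists_extend hj d
    have := h c hc
    rwa [← norm_eq_of_injective hj hd hc, ← hf.synthesis_eq,
      ← synthesis_comp_injective hj hd hc f] at this

lemma IsBessel.isRieszSequence_compl_iff {f : ι → H} (hf : IsBessel f) (σ : Finset ι) :
    IsRieszSequence (fun n : {n : ι // n ∉ σ} => f n) ↔ ∃ m : ℝ, 0 < m ∧
      ∀ c : Ell2 ι, (∀ i ∈ σ, c i = 0) → m * ‖c‖ ≤ ‖hf.synthesisCLM c‖ := by
  rw [hf.isRieszSequence_comp_iff Subtype.val_injective]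
  simp

end

/-! ### Relatively small perturbations and tails in `ℓ²` -/

section

/-- If `A` is a relatively small perturbation of `T` on the orthogonal complement of `ker T`, then
`A = U T` there for an operator `U` near the identity; only the adjoint consequences are kept. -/
lemma exists_intertwining {E H : Type*} [NormedAddCommGroup E] [InnerProductSpace ℂ E]
    [CompleteSpace E] [NormedAddCommGroup H] [InnerProductSpace ℂ H] [CompleteSpace H]
    (T A : E →L[ℂ] H) {κ r : ℝ} (hκ : 0 ≤ κ) (hr : 0 < r)
    (hT : ∀ u ∈ (LinearMap.ker (T : E →ₗ[ℂ] H))ᗮ, r * ‖u‖ ≤ ‖T u‖)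
    (hA : ∀ u ∈ (LinearMap.ker (T : E →ₗ[ℂ] H))ᗮ, ‖A u - T u‖ ≤ κ * ‖T u‖) :
    ∃ U : H →L[ℂ] H, (∀ x, (1 - κ) * ‖x‖ ≤ ‖adjoint U x‖) ∧
      ∀ x, ‖adjoint T (adjoint U x)‖ ≤ ‖adjoint A x‖ := by
  set N := LinearMap.ker (T : E →ₗ[ℂ] H) with hN
  have hNc : IsClosed (N : Set E) := T.isClosed_ker
  have : CompleteSpace N := hNc.completeSpace_coe
  set TM : Nᗮ →L[ℂ] H := T ∘L Nᗮ.subtypeL with hTM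
  have hanti : AntilipschitzWith (Real.toNNReal r⁻¹) TM := by
    refine AddMonoidHomClass.antilipschitz_of_bound TM fun u => ?_
    rw [Real.coe_toNNReal _ (by positivity), inv_mul_eq_div, le_div_iff₀' hr]
    exact hT u u.2
  have hclo : IsClosed (Set.range TM) := hanti.isClosed_range TM.uniformContinuous
  let e := TM.equivRange hanti.injective hclo
  have he : ∀ u, (e u : H) = T u := fun u => rfl
  have : CompleteSpace (LinearMap.range (TM : Nᗮ →ₗ[ℂ] H)) := hclo.completeSpace_coe
  -- `Q` is the left inverse of `T` on `Nᗮ` that kills the complement of the range, so `1 + B` sends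
  -- `T u` to `A u` for `u` in `Nᗮ`.
  let Q : H →L[ℂ] Nᗮ := (e.symm : _ →L[ℂ] Nᗮ) ∘L
    (LinearMap.range (TM : Nᗮ →ₗ[ℂ] H)).orthogonalProjectionOnto
  let B : H →L[ℂ] H := (A - T) ∘L Nᗮ.subtypeL ∘L Q
  have hB : ‖B‖ ≤ κ := by
    refine B.opNorm_le_bound hκ fun y => ?_
    refine (hA _ (Q y).2).trans ?_
    gcongr
    rw [← he]
    simp only [Q, coe_comp, Function.comp_apply, ContinuousLinearEquiv.coe_coe,
      ContinuousLinearEquiv.apply_symm_apply]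
    exact Submodule.norm_orthogonalProjectionOnto_apply_le _ y
  have hQ : ∀ u : Nᗮ, Q (T u) = u := by
    intro u
    simp only [Q, coe_comp, Function.comp_apply, ContinuousLinearEquiv.coe_coe]
    rw [ContinuousLinearEquiv.symm_apply_eq]
    rw [← he, Submodule.orthogonalProjectionOnto_mem_subspace_eq_self]
  refine ⟨1 + B, fun x => ?_, fun x => ?_⟩
  · rw [map_add, add_apply]
    have h1 : adjoint (1 : H →L[ℂ] H) = 1 := star_one _
    have h2 : ‖adjoint B x‖ ≤ κ * ‖x‖ := by
      refine (le_opNorm _ _).trans ?_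
      rw [LinearIsometryEquiv.norm_map]
      gcongr
    rw [h1, one_apply_eq_self]
    have := norm_sub_le_norm_add x (adjoint B x)
    linarith
  -- With `q` the component of `v` in `Nᗮ`: `‖v‖² = ⟨U T v, x⟩ = ⟨A q, x⟩ = ⟨q, A* x⟩ ≤ ‖v‖ ‖A* x‖`.
  · set v := adjoint T (adjoint (1 + B) x) with hv
    obtain ⟨p, hp, q, hq, hpq⟩ := N.exists_add_mem_mem_orthogonal v
    have hTv : T v = T q := by
      rw [hpq, map_add, (show T p = 0 from hp), zero_add]
    have hUT : (1 + B) (T v) = A q := by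
      have := hQ ⟨q, hq⟩
      simp only at this
      rw [hTv, add_apply, one_apply_eq_self]
      simp only [B, coe_comp, Function.comp_apply, this]
      simp
    have hqv : ‖q‖ ≤ ‖v‖ := by
      have h0 : inner ℂ p q = 0 := hq p hp
      have := norm_add_sq_eq_norm_sq_add_norm_sq_of_inner_eq_zero p q h0
      rw [← hpq] at this
      nlinarith [norm_nonneg p, norm_nonneg q, norm_nonneg v]
    have h1 : inner ℂ v v = inner ℂ q (adjoint A x) := by
      calc inner ℂ v v = inner ℂ v (adjoint T (adjoint (1 + B) x)) := rfl
        _ = _ := by rw [adjoint_inner_right, adjoint_inner_right, hUT, adjoint_inner_right]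
    have h2 : ‖v‖ * ‖v‖ ≤ ‖v‖ * ‖adjoint A x‖ := by
      have h3 : ‖inner ℂ v v‖ = ‖v‖ * ‖v‖ := by
        rw [inner_self_eq_norm_sq_to_K]
        simp [pow_two]
      rw [← h3, h1]
      exact (norm_inner_le_norm _ _).trans (by gcongr)
    rcases (norm_nonneg v).eq_or_lt with h | h
    · rw [← h]; positivity
    · exact le_of_mul_le_mul_left h2 h

variable {ι H : Type*}

lemma exists_finset_norm_inner_le (v : Ell2 ι) {ε : ℝ} (hε : 0 < ε) :
    ∃ σ : Finset ι, ∀ u : Ell2 ι, (∀ i ∈ σ, u i = 0) → ‖inner ℂ v u‖ ≤ ε * ‖u‖ := by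
  classical
  obtain ⟨σ, hσ⟩ := ((lp.hasSum_single (p := 2) (by norm_num) v).eventually
    (Metric.ball_mem_nhds v hε)).exists
  refine ⟨σ, fun u hu => ?_⟩
  have h0 : inner ℂ (∑ i ∈ σ, lp.single 2 i (v i)) u = 0 := by
    rw [sum_inner]
    refine Finset.sum_eq_zero fun i hi => ?_
    rw [lp.inner_single_left, hu i hi, inner_zero_right]
  calc ‖inner ℂ v u‖ = ‖inner ℂ (v - ∑ i ∈ σ, lp.single 2 i (v i)) u‖ := by
        rw [inner_sub_left, h0, sub_zero]
    _ ≤ ‖v - ∑ i ∈ σ, lp.single 2 i (v i)‖ * ‖u‖ := norm_inner_le_norm _ _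
    _ ≤ ε * ‖u‖ := by
        gcongr
        rw [← dist_eq_norm, dist_comm]
        exact (Metric.mem_ball.1 hσ).le

/-- Vectors of a finite-dimensional subspace are uniformly nearly orthogonal to far-out tails. -/
lemma exists_finset_norm_starProjection_le (N : Submodule ℂ (Ell2 ι)) [FiniteDimensional ℂ N]
    {ε : ℝ} (hε : 0 < ε) :
    ∃ σ : Finset ι, ∀ u : Ell2 ι, (∀ i ∈ σ, u i = 0) →
      ‖N.starProjection u‖ ≤ ε * ‖u‖ := by
  classical
  let b := stdOrthonormalBasis ℂ N
  set d := Module.finrank ℂ N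
  -- The `d + 1` keeps the tolerance meaningful when `d = 0`.
  choose σ hσ using fun k : Fin d => exists_finset_norm_inner_le (b k : Ell2 ι)
    (show 0 < ε / (d + 1) by positivity)
  refine ⟨Finset.univ.biUnion σ, fun u hu => ?_⟩
  have h1 : N.starProjection u = ∑ k, inner ℂ (b k : Ell2 ι) u • (b k : Ell2 ι) := by
    rw [Submodule.starProjection_apply, b.orthogonalProjectionOnto_apply_eq_sum]
    simp
  rw [h1]
  calc ‖∑ k, inner ℂ (b k : Ell2 ι) u • (b k : Ell2 ι)‖
      ≤ ∑ k : Fin d, ε / (d + 1) * ‖u‖ := by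
        refine norm_sum_le_of_le _ fun k _ => ?_
        have : ‖(b k : Ell2 ι)‖ = 1 := b.norm_eq_one k
        rw [norm_smul, this, mul_one]
        exact hσ k u fun i hi => hu i (Finset.mem_biUnion.2 ⟨k, Finset.mem_univ _, hi⟩)
    _ = d / (d + 1) * (ε * ‖u‖) := by
        rw [Finset.sum_const, Finset.card_univ, Fintype.card_fin, nsmul_eq_mul]; ring
    _ ≤ 1 * (ε * ‖u‖) := by
        gcongr
        rw [div_le_one (by positivity)]
        linarith
    _ = _ := one_mul _

/-- An operator bounded below on a finite-codimensional subspace of `ℓ²` is bounded below on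
sequences vanishing on a suitable finite set. -/
lemma exists_finset_bounded_below [NormedAddCommGroup H] [NormedSpace ℂ H]
    (A : Ell2 ι →L[ℂ] H) (N : Submodule ℂ (Ell2 ι)) [FiniteDimensional ℂ N] {δ : ℝ} (hδ : 0 < δ)
    (hA : ∀ u ∈ Nᗮ, δ * ‖u‖ ≤ ‖A u‖) :
    ∃ σ : Finset ι, ∃ m : ℝ, 0 < m ∧
      ∀ u : Ell2 ι, (∀ i ∈ σ, u i = 0) → m * ‖u‖ ≤ ‖A u‖ := by
  -- With `P` the projection onto `N`, `‖A u‖ ≥ δ‖u‖ - (δ + ‖A‖)‖P u‖`; this tolerance makes the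
  -- loss at most `δ/2 * ‖u‖`.
  obtain ⟨σ, hσ⟩ := exists_finset_norm_starProjection_le N
    (show 0 < δ / (2 * (δ + ‖A‖)) by positivity)
  refine ⟨σ, δ / 2, by positivity, fun u hu => ?_⟩
  have h1 := hA _ (N.sub_starProjection_mem_orthogonal u)
  have h2 := hσ u hu
  rw [map_sub] at h1
  have h3 := norm_sub_le (A u) (A (N.starProjection u))
  have h4 := A.le_opNorm (N.starProjection u)
  have h5 := norm_sub_norm_le u (N.starProjection u)
  have h6 : (δ + ‖A‖) * ‖N.starProjection u‖ ≤ δ / 2 * ‖u‖ := by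
    calc _ ≤ (δ + ‖A‖) * (δ / (2 * (δ + ‖A‖)) * ‖u‖) := by gcongr
      _ = _ := by
        have : δ + ‖A‖ ≠ 0 := by positivity
        field_simp
  nlinarith

end

/-! ### From the perturbation inequality and the gap to operator bounds -/

section

variable {ι H : Type*} [NormedAddCommGroup H] [InnerProductSpace ℂ H]

/-- A bound on finite combinations makes a sequence Bessel. -/
lemma isBessel_of_norm_sum_le {g : ℕ → H} {K : ℝ} (hK : 0 < K)
    (h : ∀ (n : ℕ) (c : ℕ → ℂ), ‖∑ i ∈ Finset.range n, c i • g i‖ ≤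
      K * Real.sqrt (∑ i ∈ Finset.range n, ‖c i‖ ^ 2)) : IsBessel g := by
  have key : ∀ (x : H) (n : ℕ),
      ∑ i ∈ Finset.range n, ‖inner ℂ x (g i)‖ ^ 2 ≤ K ^ 2 * ‖x‖ ^ 2 := by
    intro x n
    simp_rw [norm_inner_symm x]
    -- Testing with `c i = ⟨g i, x⟩` makes the pairing of the sum with `x` equal to `s`, so `s ≤ K
    -- √s ‖x‖`.
    have hc := h n fun i => inner ℂ (g i) x
    set s := ∑ i ∈ Finset.range n, ‖inner ℂ (g i) x‖ ^ 2 with hs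
    have hs0 : 0 ≤ s := Finset.sum_nonneg fun _ _ => by positivity
    have h1 : inner ℂ (∑ i ∈ Finset.range n, (inner ℂ (g i) x : ℂ) • g i) x = (s : ℂ) := by
      rw [sum_inner, hs]
      push_cast
      refine Finset.sum_congr rfl fun i _ => ?_
      rw [inner_smul_left]
      exact Complex.conj_mul' _
    have h2 : s ≤ K * Real.sqrt s * ‖x‖ := by
      calc s = ‖(s : ℂ)‖ := by rw [Complex.norm_real, Real.norm_of_nonneg hs0]
        _ ≤ _ := by
          rw [← h1]
          exact (norm_inner_le_norm _ _).trans (by gcongr)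
    have h3 : Real.sqrt s ≤ K * ‖x‖ := by
      rcases (Real.sqrt_nonneg s).eq_or_lt with h0 | h0
      · rw [← h0]; positivity
      · refine le_of_mul_le_mul_right ?_ h0
        rw [Real.mul_self_sqrt hs0]
        linarith
    calc s = Real.sqrt s ^ 2 := (Real.sq_sqrt hs0).symm
      _ ≤ (K * ‖x‖) ^ 2 := by gcongr
      _ = _ := mul_pow _ _ _
  exact ⟨K ^ 2, by positivity, fun x =>
    ⟨summable_of_sum_range_le (fun _ => by positivity) (key x),
      Real.tsum_le_of_sum_range_le (fun _ => by positivity) (key x)⟩⟩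

variable [CompleteSpace H]

lemma IsBessel.nullSpace_eq {f : ι → H} (hf : IsBessel f) :
    nullSpace f = (LinearMap.ker (hf.synthesisCLM : Ell2 ι →ₗ[ℂ] H) : Set (Ell2 ι)) := by
  ext c
  simp [nullSpace, hf.synthesis_eq]

/-- By Pythagoras the nearest point of `N` is `0`. This converts the distance in `reducedMinModulus`
into a norm. -/
lemma infDist_eq_norm_of_mem_orthogonal {𝕜 E : Type*} [RCLike 𝕜] [NormedAddCommGroup E]
    [InnerProductSpace 𝕜 E] (N : Submodule 𝕜 E) {u : E} (hu : u ∈ Nᗮ) :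
    Metric.infDist u (N : Set E) = ‖u‖ := by
  refine le_antisymm ?_ ?_
  · simpa using Metric.infDist_le_dist_of_mem (x := u) N.zero_mem
  · refine (Metric.le_infDist ⟨0, N.zero_mem⟩).2 fun v hv => ?_
    rw [dist_eq_norm]
    have h0 : inner 𝕜 u v = 0 := N.inner_left_of_mem_orthogonal hv hu
    have h1 := norm_sub_sq (𝕜 := 𝕜) u v
    rw [h0, map_zero] at h1
    nlinarith [norm_nonneg u, norm_nonneg v, norm_nonneg (u - v)]

/-- The gap condition makes the perturbation relatively small on `(ker S_f)ᗮ`. -/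
lemma IsBessel.exists_relative_bound {f : ι → H} (hf : IsBessel f) {lam mu : ℝ}
    (hlam : 0 ≤ lam) (hmu : 0 ≤ mu)
    (hgap : (mu : EReal) < ((1 - lam : ℝ) : EReal) * reducedMinModulus f) :
    ∃ κ r : ℝ, 0 ≤ κ ∧ κ < 1 ∧ 0 < r ∧
      ∀ u ∈ (LinearMap.ker (hf.synthesisCLM : Ell2 ι →ₗ[ℂ] H))ᗮ,
        r * ‖u‖ ≤ ‖hf.synthesisCLM u‖ ∧
          lam * ‖hf.synthesisCLM u‖ + mu * ‖u‖ ≤ κ * ‖hf.synthesisCLM u‖ := by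
  have hγ : 0 ≤ reducedMinModulus f :=
    le_iInf₂ fun c _ => EReal.coe_nonneg.2 (div_nonneg (norm_nonneg _) Metric.infDist_nonneg)
  have hmu' : (0 : EReal) ≤ mu := EReal.coe_nonneg.2 hmu
  have hlam1 : lam < 1 := by
    by_contra h
    have h1 : ((1 - lam : ℝ) : EReal) ≤ 0 := by
      rw [← EReal.coe_zero, EReal.coe_le_coe_iff]
      linarith
    exact absurd (hgap.trans_le (mul_nonpos_of_nonpos_of_nonneg h1 hγ)) (not_lt.2 hmu')
  set N := LinearMap.ker (hf.synthesisCLM : Ell2 ι →ₗ[ℂ] H) with hN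
  have key : ∀ u ∈ Nᗮ, u ≠ 0 →
      reducedMinModulus f ≤ ((‖hf.synthesisCLM u‖ / ‖u‖ : ℝ) : EReal) := by
    intro u hu hu0
    have huN : u ∉ nullSpace f := by
      rw [hf.nullSpace_eq]
      intro h
      exact hu0 (inner_self_eq_zero.1 (hu u h))
    refine (iInf₂_le u huN).trans_eq ?_
    rw [hf.nullSpace_eq, infDist_eq_norm_of_mem_orthogonal N hu, hf.synthesis_eq]
  -- If `Nᗮ` is trivial then `S_f = 0`, the modulus is `⊤`, and any positive `r` serves.
  by_cases hM : ∀ u ∈ Nᗮ, u = 0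
  · refine ⟨lam, 1, hlam, hlam1, one_pos, fun u hu => ?_⟩
    rw [hM u hu]
    simp
  · push Not at hM
    obtain ⟨u₀, hu₀, hu₀0⟩ := hM
    have htop : reducedMinModulus f ≠ ⊤ :=
      ((key u₀ hu₀ hu₀0).trans_lt (EReal.coe_lt_top _)).ne
    have hbot : reducedMinModulus f ≠ ⊥ := (EReal.bot_lt_zero.trans_le hγ).ne'
    obtain ⟨r, hr⟩ : ∃ r : ℝ, (r : EReal) = reducedMinModulus f :=
      ⟨_, EReal.coe_toReal htop hbot⟩
    rw [← hr] at hgap hγ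
    rw [← EReal.coe_mul, EReal.coe_lt_coe_iff] at hgap
    have hr0 : 0 < r := by
      rcases (EReal.coe_nonneg.1 hγ).eq_or_lt with h | h
      · rw [← h, mul_zero] at hgap; linarith
      · exact h
    refine ⟨lam + mu / r, r, by positivity, ?_, hr0, fun u hu => ?_⟩
    · have := (div_lt_iff₀ hr0).2 hgap
      linarith
    · have h1 : r * ‖u‖ ≤ ‖hf.synthesisCLM u‖ := by
        rcases eq_or_ne u 0 with rfl | hu0
        · simp
        · have := key u hu hu0
          rw [← hr, EReal.coe_le_coe_iff] at this
          rwa [le_div_iff₀ (norm_pos_iff.2 hu0)] at this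
      refine ⟨h1, ?_⟩
      rw [add_mul, add_le_add_iff_left, div_mul_eq_mul_div, le_div_iff₀ hr0]
      calc mu * ‖u‖ * r = mu * (r * ‖u‖) := by ring
        _ ≤ _ := by gcongr

lemma IsBessel.norm_sum_smul_le {f : ι → H} (hf : IsBessel f) (c : ι → ℂ) (s : Finset ι) :
    ‖∑ i ∈ s, c i • f i‖ ≤ ‖hf.synthesisCLM‖ * Real.sqrt (∑ i ∈ s, ‖c i‖ ^ 2) := by
  classical
  set d : Ell2 ι := ∑ i ∈ s, lp.single 2 i (c i) with hd
  have hdn : ‖d‖ = Real.sqrt (∑ i ∈ s, ‖c i‖ ^ 2) := by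
    have := lp.norm_sum_single (p := 2) (E := fun _ : ι => ℂ) (by norm_num) c s
    rw [eq_comm, Real.sqrt_eq_iff_eq_sq (by positivity) (norm_nonneg _)]
    simpa using this.symm
  have hsingle : ∀ i, hf.synthesisCLM (lp.single 2 i (c i)) = c i • f i := by
    intro i
    refine ext_inner_right ℂ fun x => ?_
    rw [hf.inner_synthesisCLM, lp.inner_single_left, hf.analysis_apply, inner_smul_left]
    simp [mul_comm]
  have := hf.synthesisCLM.le_opNorm d
  rwa [hdn, hd, map_sum, Finset.sum_congr rfl fun i _ => hsingle i] at this

section Perturbation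

variable {f g : ℕ → H} {lam mu : ℝ}

lemma IsBessel.of_perturbation (hf : IsBessel f) (hlam : 0 ≤ lam) (hmu : 0 ≤ mu)
    (hpert : ∀ (n : ℕ) (c : Fin n → ℂ),
      ‖∑ i, c i • (g i - f i)‖ ≤ lam * ‖∑ i, c i • f i‖ + mu * Real.sqrt (∑ i, ‖c i‖ ^ 2)) :
    IsBessel g := by
  -- The final `+ 1` only ensures a positive constant.
  refine isBessel_of_norm_sum_le (K := (1 + lam) * ‖hf.synthesisCLM‖ + mu + 1) (by positivity)
    fun n c => ?_
  have h1 := hpert n fun i => c i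
  rw [← Finset.sum_range fun i => c i • (g i - f i), ← Finset.sum_range fun i => c i • f i,
    ← Finset.sum_range fun i => ‖c i‖ ^ 2] at h1
  have h2 := hf.norm_sum_smul_le c (Finset.range n)
  simp_rw [smul_sub, Finset.sum_sub_distrib] at h1
  have h3 := norm_sub_norm_le (∑ i ∈ Finset.range n, c i • g i) (∑ i ∈ Finset.range n, c i • f i)
  have h4 := mul_le_mul_of_nonneg_left h2 hlam
  have h5 := Real.sqrt_nonneg (∑ i ∈ Finset.range n, ‖c i‖ ^ 2)
  linarith

/-- The hypothesis for finite sums passes to the limit along partial sums. -/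
lemma norm_synthesisCLM_sub_le (hf : IsBessel f) (hg : IsBessel g) (hmu : 0 ≤ mu)
    (hpert : ∀ (n : ℕ) (c : Fin n → ℂ),
      ‖∑ i, c i • (g i - f i)‖ ≤ lam * ‖∑ i, c i • f i‖ + mu * Real.sqrt (∑ i, ‖c i‖ ^ 2))
    (c : Ell2 ℕ) :
    ‖hg.synthesisCLM c - hf.synthesisCLM c‖ ≤ lam * ‖hf.synthesisCLM c‖ + mu * ‖c‖ := by
  have hF := (hf.hasSum_synthesisCLM c).tendsto_sum_nat
  have hG := (hg.hasSum_synthesisCLM c).tendsto_sum_nat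
  refine le_of_tendsto_of_tendsto' (hG.sub hF).norm
    ((hF.norm.const_mul lam).add_const (mu * ‖c‖)) fun n => ?_
  have h1 := hpert n fun i => c i
  rw [← Finset.sum_range fun i => c i • (g i - f i), ← Finset.sum_range fun i => c i • f i,
    ← Finset.sum_range fun i => ‖c i‖ ^ 2] at h1
  simp_rw [smul_sub, Finset.sum_sub_distrib] at h1
  refine h1.trans ?_
  gcongr
  rw [Real.sqrt_le_left (norm_nonneg _), norm_sq_eq_tsum]
  exact (summable_norm_sq c).sum_le_tsum _ fun _ _ => by positivity

end Perturbation

/-- The null space of the synthesis operator of a pseudo-Riesz sequence is finite-dimensional. -/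
lemma IsBessel.finiteDimensional_ker {f : ι → H} (hf : IsBessel f) {σ : Finset ι}
    (h : IsRieszSequence fun n : {n : ι // n ∉ σ} => f n) :
    FiniteDimensional ℂ (LinearMap.ker (hf.synthesisCLM : Ell2 ι →ₗ[ℂ] H)) := by
  obtain ⟨m, hm, h⟩ := (hf.isRieszSequence_compl_iff σ).1 h
  -- A kernel element is determined by its coordinates in `σ`: if they vanish, the Riesz bound
  -- forces it to be zero.
  let φ : LinearMap.ker (hf.synthesisCLM : Ell2 ι →ₗ[ℂ] H) →ₗ[ℂ] (σ → ℂ) :=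
    { toFun := fun c i => (c : Ell2 ι) i
      map_add' := fun _ _ => rfl
      map_smul' := fun _ _ => rfl }
  refine FiniteDimensional.of_injective φ ((injective_iff_map_eq_zero φ).2 fun c hc => ?_)
  have h1 := h c fun i hi => congrFun hc ⟨i, hi⟩
  have h2 : hf.synthesisCLM (c : Ell2 ι) = 0 := c.2
  rw [h2, norm_zero] at h1
  have h3 : ‖(c : Ell2 ι)‖ = 0 := by nlinarith [norm_nonneg (c : Ell2 ι)]
  exact Subtype.ext (norm_eq_zero.1 h3)

end

/-! ### Pseudo-Riesz bases and the stability statements -/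

section

variable {H : Type*} [NormedAddCommGroup H] [InnerProductSpace ℂ H]

/-- Restoring the removed members only increases the sum in the lower frame bound. -/
lemma IsPseudoRieszBasis.isPseudoFrame {f : ℕ → H} (hf : IsPseudoRieszBasis f) :
    IsPseudoFrame f := by
  obtain ⟨hB, σ, m, h, ⟨-, r, hr, hle⟩, -⟩ := hf
  have hh := isBessel_of_finite h
  refine ⟨hB, m, h, hh.elim hB, r, hr, fun x => (hle x).trans ?_⟩
  rw [hh.tsum_elim hB, hh.tsum_elim (hB.comp_injective Subtype.val_injective)]
  obtain ⟨M, -, hM⟩ := hB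
  gcongr
  exact tsum_comp_le_tsum_of_inj (hM x).1 (fun _ => by positivity) Subtype.val_injective

variable [CompleteSpace H]

lemma IsRieszSequence.comp_injective {ι κ : Type*} {f : ι → H} (hf : IsRieszSequence f)
    {j : κ → ι} (hj : Function.Injective j) : IsRieszSequence fun k => f (j k) := by
  obtain ⟨m, hm, h⟩ := hf.1.isRieszSequence_iff.1 hf
  exact (hf.1.isRieszSequence_comp_iff hj).2
    ⟨m, hm, fun c _ => (h c).trans_eq (by rw [hf.1.synthesis_eq])⟩

lemma IsPseudoRieszBasis.isPseudoRieszSequence {f : ℕ → H} (hf : IsPseudoRieszBasis f) :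
    IsPseudoRieszSequence f := by
  obtain ⟨hB, σ, m, h, -, hR⟩ := hf
  have hk := hR.comp_injective (j := Sum.inr) Sum.inr_injective
  simp only [Sum.elim_inr] at hk
  exact ⟨hB, σ, hk⟩

/-- A Riesz sequence with finite-dimensional orthogonal complement is completed to a Riesz basis
by an orthonormal basis of that complement. -/
lemma IsRieszSequence.exists_isRieszBasis {κ : Type*} {k : κ → H} (hk : IsRieszSequence k)
    (hW : FiniteDimensional ℂ (LinearMap.range (hk.1.synthesisCLM : Ell2 κ →ₗ[ℂ] H))ᗮ) :
    ∃ (m : ℕ) (h : Fin m → H), IsRieszBasis (Sum.elim h k) := by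
  obtain ⟨m, hm, hS⟩ := hk.1.isRieszSequence_iff.1 hk
  have hkB := hk.1
  simp_rw [hkB.synthesis_eq] at hS
  set S := hkB.synthesisCLM with hSdef
  set R := LinearMap.range (S : Ell2 κ →ₗ[ℂ] H) with hR
  have hanti : AntilipschitzWith (Real.toNNReal m⁻¹) S := by
    refine AddMonoidHomClass.antilipschitz_of_bound S fun u => ?_
    rw [Real.coe_toNNReal _ (by positivity), inv_mul_eq_div, le_div_iff₀' hm]
    exact hS u
  have hclo : IsClosed (R : Set H) := by
    rw [hR, LinearMap.coe_range]
    exact hanti.isClosed_range S.uniformContinuous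
  have : CompleteSpace R := hclo.completeSpace_coe
  let b := stdOrthonormalBasis ℂ Rᗮ
  let h : Fin (Module.finrank ℂ Rᗮ) → H := fun i => b i
  have hh := isBessel_of_finite h
  have hF := hh.elim hkB
  refine ⟨_, h, ⟨hF, min 1 (m ^ 2), by positivity, fun x => ?_⟩,
    hF, min 1 (m ^ 2), by positivity, fun c => ?_⟩
  · obtain ⟨y, hy, w, hw, rfl⟩ := R.exists_add_mem_mem_orthogonal x
    have h0 : inner ℂ y w = 0 := hw y hy
    have hxx := norm_add_sq_eq_norm_sq_add_norm_sq_of_inner_eq_zero y w h0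
    rw [hh.tsum_elim hkB, tsum_fintype, ← hkB.norm_sq_analysis]
    have h1 : ∑ i, ‖inner ℂ (y + w) (h i)‖ ^ 2 = ‖w‖ ^ 2 := by
      rw [show ‖w‖ = ‖(⟨w, hw⟩ : Rᗮ)‖ from rfl, ← b.sum_sq_norm_inner_left]
      refine Finset.sum_congr rfl fun i _ => ?_
      rw [inner_add_left, show inner ℂ y (h i) = 0 from (b i).2 y hy, zero_add]
      rfl
    have hw0 : hkB.analysis w = 0 := by
      refine ext_inner_left ℂ fun d => ?_
      rw [← hkB.inner_synthesisCLM, inner_zero_right]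
      exact hw _ ⟨d, rfl⟩
    -- For `y = S d`, `‖y‖² = ⟨d, S* y⟩ ≤ ‖d‖ ‖S* y‖` and `m‖d‖ ≤ ‖y‖`.
    have h2 : m * ‖y‖ ≤ ‖hkB.analysis y‖ := by
      obtain ⟨d, rfl⟩ := hy
      simp only [coe_coe] at *
      have h3 : ‖inner ℂ (S d) (S d)‖ = ‖S d‖ * ‖S d‖ := by
        rw [inner_self_eq_norm_sq_to_K]
        simp [pow_two]
      have h4 : ‖S d‖ * ‖S d‖ ≤ ‖d‖ * ‖hkB.analysis (S d)‖ := by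
        rw [← h3, hSdef, hkB.inner_synthesisCLM]
        exact norm_inner_le_norm _ _
      rcases (norm_nonneg (S d)).eq_or_lt with h5 | h5
      · rw [← h5, mul_zero]; positivity
      · refine le_of_mul_le_mul_right ?_ h5
        calc m * ‖S d‖ * ‖S d‖ ≤ m * (‖d‖ * ‖hkB.analysis (S d)‖) := by
              rw [mul_assoc]; gcongr
          _ = (m * ‖d‖) * ‖hkB.analysis (S d)‖ := by ring
          _ ≤ ‖S d‖ * ‖hkB.analysis (S d)‖ := by gcongr; exact hS d
          _ = _ := mul_comm _ _
    rw [h1, map_add, hw0, add_zero]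
    have h3 : (m * ‖y‖) ^ 2 ≤ ‖hkB.analysis y‖ ^ 2 := by gcongr
    have h4 := mul_le_mul_of_nonneg_right (min_le_left 1 (m ^ 2)) (sq_nonneg ‖w‖)
    have h5 := mul_le_mul_of_nonneg_right (min_le_right 1 (m ^ 2)) (sq_nonneg ‖y‖)
    rw [mul_pow] at h3
    rw [pow_two ‖y + w‖, hxx, ← pow_two, ← pow_two, mul_add]
    linarith
  · obtain ⟨d, hd⟩ := exists_restrict (Sum.inr_injective (α := Fin (Module.finrank ℂ Rᗮ))) c
    have hsum : synthesis (Sum.elim h k) c = ∑ i, c (Sum.inl i) • h i + S d := by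
      refine HasSum.tsum_eq (HasSum.sum (hasSum_fintype _) ?_)
      have := hkB.hasSum_synthesisCLM d
      simp_rw [hd] at this
      exact this
    have hcsq : ∑' i, ‖c i‖ ^ 2 = ∑ i, ‖c (Sum.inl i)‖ ^ 2 + ‖d‖ ^ 2 := by
      rw [norm_sq_eq_tsum d]
      simp_rw [hd]
      exact HasSum.tsum_eq (HasSum.sum (hasSum_fintype _)
        ((summable_norm_sq c).comp_injective Sum.inr_injective).hasSum)
    have hw : ∑ i, c (Sum.inl i) • h i ∈ Rᗮ :=
      Submodule.sum_mem _ fun i _ => Submodule.smul_mem _ _ (b i).2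
    have h1 : ‖∑ i, c (Sum.inl i) • h i‖ ^ 2 = ∑ i, ‖c (Sum.inl i)‖ ^ 2 := by
      have h2 : ∑ i, c (Sum.inl i) • h i = ((∑ i, c (Sum.inl i) • b i : Rᗮ) : H) := by
        simp [h]
      rw [h2]
      refine (b.sum_sq_norm_inner_right (∑ i, c (Sum.inl i) • b i)).symm.trans ?_
      refine Finset.sum_congr rfl fun i _ => ?_
      rw [b.orthonormal.inner_right_fintype]
    have h0 : inner ℂ (∑ i, c (Sum.inl i) • h i) (S d) = 0 :=
      R.inner_left_of_mem_orthogonal ⟨d, rfl⟩ hw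
    have h2 := norm_add_sq_eq_norm_sq_add_norm_sq_of_inner_eq_zero _ _ h0
    have h3 : (m * ‖d‖) ^ 2 ≤ ‖S d‖ ^ 2 := by
      gcongr
      exact hS d
    rw [hsum, hcsq, ← h1]
    have h4 := mul_le_mul_of_nonneg_right (min_le_left 1 (m ^ 2))
      (sq_nonneg ‖∑ i, c (Sum.inl i) • h i‖)
    have h5 := mul_le_mul_of_nonneg_right (min_le_right 1 (m ^ 2)) (sq_nonneg ‖d‖)
    rw [mul_pow] at h3
    rw [pow_two ‖_ + S d‖, h2, ← pow_two, ← pow_two, mul_add]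
    linarith

/-- A vector orthogonal to the retained members, the removed ones and the added ones is zero by the
frame bound. Hence the complement of the retained span embeds in a finite-dimensional coordinate
space. -/
lemma IsPseudoFrame.isPseudoRieszBasis {f : ℕ → H} (hf : IsPseudoFrame f)
    (hR : IsPseudoRieszSequence f) : IsPseudoRieszBasis f := by
  obtain ⟨hB, m, h, -, r, hr, hle⟩ := hf
  obtain ⟨-, σ, hk⟩ := hR
  refine ⟨hB, σ, hk.exists_isRieszBasis ?_⟩
  set W := (LinearMap.range (hk.1.synthesisCLM : Ell2 {n : ℕ // n ∉ σ} →ₗ[ℂ] H))ᗮ with hW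
  let φ : W →ₗ[ℂ] (Fin m → ℂ) × (σ → ℂ) :=
    { toFun := fun x => (fun i => inner ℂ (h i) (x : H), fun i => inner ℂ (f i) (x : H))
      map_add' := fun x y => by ext <;> simp
      map_smul' := fun a x => by ext <;> simp }
  refine FiniteDimensional.of_injective φ ((injective_iff_map_eq_zero φ).2 fun x hx => ?_)
  have h1 : ∀ i, inner ℂ (h i) (x : H) = 0 := fun i => congrFun (congrArg Prod.fst hx) i
  have h2 : ∀ n, inner ℂ (f n) (x : H) = 0 := by
    intro n
    by_cases hn : n ∈ σ
    · exact congrFun (congrArg Prod.snd hx) ⟨n, hn⟩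
    · have hx0 : hk.1.analysis (x : H) = 0 := by
        refine ext_inner_left ℂ fun d => ?_
        rw [← hk.1.inner_synthesisCLM, inner_zero_right]
        exact x.2 _ ⟨d, rfl⟩
      have := hk.1.analysis_apply (x : H) ⟨n, hn⟩
      rw [hx0] at this
      exact this.symm
  have h3 := hle x
  rw [(isBessel_of_finite h).tsum_elim hB] at h3
  simp_rw [norm_inner_symm (x : H), h1, h2] at h3
  simp only [norm_zero, ne_eq, OfNat.ofNat_ne_zero, not_false_eq_true, zero_pow, tsum_zero,
    add_zero] at h3
  have h4 : ‖(x : H)‖ ^ 2 = 0 := le_antisymm (by nlinarith) (sq_nonneg _)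
  exact Subtype.ext (norm_eq_zero.1 (pow_eq_zero_iff two_ne_zero |>.1 h4))

/-- Stability of pseudo-frames under relatively small perturbations. -/
lemma IsPseudoFrame.of_relative_bound {f g : ℕ → H} (hf : IsPseudoFrame f) (hg : IsBessel g)
    {κ r : ℝ} (hκ : 0 ≤ κ) (hκ1 : κ < 1) (hr : 0 < r)
    (hT : ∀ u ∈ (LinearMap.ker (hf.1.synthesisCLM : Ell2 ℕ →ₗ[ℂ] H))ᗮ,
      r * ‖u‖ ≤ ‖hf.1.synthesisCLM u‖)
    (hA : ∀ u ∈ (LinearMap.ker (hf.1.synthesisCLM : Ell2 ℕ →ₗ[ℂ] H))ᗮ,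
      ‖hg.synthesisCLM u - hf.1.synthesisCLM u‖ ≤ κ * ‖hf.1.synthesisCLM u‖) :
    IsPseudoFrame g := by
  have hB := hf.1
  obtain ⟨m, h, -, s, hs, hle⟩ := hf.2
  obtain ⟨U, hU1, hU2⟩ := exists_intertwining _ _ hκ hr hT hA
  rw [hg.adjoint_synthesisCLM, hB.adjoint_synthesisCLM] at hU2
  have hh := isBessel_of_finite h
  -- The added vectors are moved by `U` because `⟨U (h i), y⟩ = ⟨h i, U* y⟩`.
  have hUh := isBessel_of_finite fun i => U (h i)
  have h1κ : 0 < 1 - κ := by linarith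
  refine ⟨hg, m, fun i => U (h i), hUh.elim hg, s * (1 - κ) ^ 2, by positivity, fun x => ?_⟩
  have h1 := hle (adjoint U x)
  rw [hh.tsum_elim hB, ← hB.norm_sq_analysis] at h1
  simp_rw [adjoint_inner_left] at h1
  rw [hUh.tsum_elim hg, ← hg.norm_sq_analysis]
  calc s * (1 - κ) ^ 2 * ‖x‖ ^ 2 = s * ((1 - κ) * ‖x‖) ^ 2 := by ring
    _ ≤ s * ‖adjoint U x‖ ^ 2 := by gcongr; exact hU1 x
    _ ≤ _ := h1
    _ ≤ _ := by gcongr; exact hU2 x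

/-- Stability of pseudo-Riesz sequences under relatively small perturbations. -/
lemma IsPseudoRieszSequence.of_relative_bound {f g : ℕ → H} (hf : IsPseudoRieszSequence f)
    (hg : IsBessel g) {κ r : ℝ} (hκ1 : κ < 1) (hr : 0 < r)
    (hT : ∀ u ∈ (LinearMap.ker (hf.1.synthesisCLM : Ell2 ℕ →ₗ[ℂ] H))ᗮ,
      r * ‖u‖ ≤ ‖hf.1.synthesisCLM u‖)
    (hA : ∀ u ∈ (LinearMap.ker (hf.1.synthesisCLM : Ell2 ℕ →ₗ[ℂ] H))ᗮ,
      ‖hg.synthesisCLM u - hf.1.synthesisCLM u‖ ≤ κ * ‖hf.1.synthesisCLM u‖) :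
    IsPseudoRieszSequence g := by
  obtain ⟨hB, σ, hk⟩ := hf
  have := hB.finiteDimensional_ker hk
  have h1κ : 0 < 1 - κ := by linarith
  -- On `(ker T)ᗮ`, `‖A u‖ ≥ (1 - κ)‖T u‖ ≥ (1 - κ) r ‖u‖`.
  obtain ⟨τ, hτ⟩ := exists_finset_bounded_below hg.synthesisCLM
    (LinearMap.ker (hB.synthesisCLM : Ell2 ℕ →ₗ[ℂ] H)) (δ := (1 - κ) * r) (by positivity)
    fun u hu => by
      have h1 := hA u hu
      have h2 := mul_le_mul_of_nonneg_left (hT u hu) h1κ.le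
      have h3 := norm_sub_norm_le (hB.synthesisCLM u) (hg.synthesisCLM u)
      rw [norm_sub_rev] at h3
      linarith
  exact ⟨hg, τ, (hg.isRieszSequence_compl_iff τ).2 hτ⟩

end

end HilbertSeq

theorem mainTheorem3 {H : Type*} [NormedAddCommGroup H] [InnerProductSpace ℂ H] [CompleteSpace H]
    [TopologicalSpace.SeparableSpace H] (f g : ℕ → H) (lam mu : ℝ)
    (hlam : 0 ≤ lam) (hmu : 0 ≤ mu)
    (hpert : ∀ (n : ℕ) (c : Fin n → ℂ),
      ‖∑ i, c i • (g i - f i)‖ ≤ lam * ‖∑ i, c i • f i‖ + mu * Real.sqrt (∑ i, ‖c i‖ ^ 2))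
    (hgap : (mu : EReal) < ((1 - lam : ℝ) : EReal) * HilbertSeq.reducedMinModulus f) :
    (HilbertSeq.IsPseudoRieszSequence f → HilbertSeq.IsPseudoRieszSequence g) ∧
      (HilbertSeq.IsPseudoFrame f → HilbertSeq.IsPseudoFrame g) ∧
      (HilbertSeq.IsPseudoRieszBasis f → HilbertSeq.IsPseudoRieszBasis g) := by
  have hR : HilbertSeq.IsPseudoRieszSequence f → HilbertSeq.IsPseudoRieszSequence g := fun hf => by
    obtain ⟨κ, r, -, hκ1, hr, hb⟩ := hf.1.exists_relative_bound hlam hmu hgap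
    have hg := hf.1.of_perturbation hlam hmu hpert
    exact hf.of_relative_bound hg hκ1 hr (fun u hu => (hb u hu).1) fun u hu =>
      (HilbertSeq.norm_synthesisCLM_sub_le hf.1 hg hmu hpert u).trans (hb u hu).2
  have hF : HilbertSeq.IsPseudoFrame f → HilbertSeq.IsPseudoFrame g := fun hf => by
    obtain ⟨κ, r, hκ, hκ1, hr, hb⟩ := hf.1.exists_relative_bound hlam hmu hgap
    have hg := hf.1.of_perturbation hlam hmu hpert
    exact hf.of_relative_bound hg hκ hκ1 hr (fun u hu => (hb u hu).1) fun u hu =>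
      (HilbertSeq.norm_synthesisCLM_sub_le hf.1 hg hmu hpert u).trans (hb u hu).2
  exact ⟨hR, hF, fun hf => (hF hf.isPseudoFrame).isPseudoRieszBasis (hR hf.isPseudoRieszSequence)⟩
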